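/- All rings are commutative with $1$. For a ring $R$ and an ideal $I\subseteq R$ let $\mu(I)$ be the minimal cardinality of a generating set of $I$. Put $$\operatorname{rk} R=\sup\{\mu(I) : I \text{ an ideal of } R\},\qquad \operatorname{lrk} R=\sup\{\operatorname{rk} R_{\mathfrak m} : \mathfrak m \text{ a maximal ideal of } R\},$$ where the supremum of the empty set is $0$. A ring $R$ is said to be of local rank if $\operatorname{rk} R=\operatorname{lrk} R$. Proposition. Let $A$ be a ring. 1. If $A$ is Artinian, then the polynomial ring $A[t]$ is of local rank, i.e. $\operatorname{rk} A[t]=\operatorname{lrk} A[t]$. 2. Let $n\ge 1$. If the polynomial ring $A[t_1,\dots,t_n]$ is Noetherian, then it is of local rank. -/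

import Mathlib

open scoped Polynomial

universe u

/-- The rank `rk R` of a commutative ring: the supremum, over all ideals `I` of `R`, of the
minimal cardinality of a generating set of `I`. -/
noncomputable def ringRk (R : Type u) [CommRing R] : Cardinal.{u} :=
  ⨆ I : Ideal R, Submodule.spanRank I

/-- `lrk R`: the supremum of the ranks of the localizations of `R` at its maximal ideals.
It is `0` for the zero ring. -/
noncomputable def ringLrk (R : Type u) [CommRing R] : Cardinal.{u} :=
  ⨆ m : MaximalSpectrum R, ringRk (Localization.AtPrime m.asIdeal)

/-- A ring `R` is of local rank if `rk R = lrk R`. -/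
def IsOfLocalRank (R : Type u) [CommRing R] : Prop :=
  ringRk R = ringLrk R

/-! Ideals of a localization are extended, so lrk ≤ rk always. A Noetherian ring has rk ≤ ℵ₀, so
only a finite lrk = d needs work; then `I / M I` has d generators for every ideal `I` and maximal
ideal `M`.

If `A` is Artinian, each `A[X] / pA[X]` with `p` maximal is a PID. Over a PID, lift a basis of the
torsion-free quotient of a module: it is independent modulo every `M`, and it generates except at
the finitely many `M` containing an annihilator `f` of the torsion. There, Steinitz completes it to
d generators, and Chinese remaindering makes the completion uniform. Chinese remaindering over the
finitely many `p`, then Nakayama, gives d generators of `I`.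

If `A` is Noetherian but not Artinian, some maximal `m` has strictly decreasing powers. With `M =
(m, X)` and `a i ∈ m ^ i \ m ^ (i + 1)`, the `d + 1` elements `a i * X ^ (d - i)` are independent in
`M ^ d / M ^ (d + 1)`, so lrk is infinite. Several variables reduce to one by moving variables into
the coefficients. -/

/-! ### Nakayama, Chinese remaindering and Steinitz exchange -/

/-- A submodule `J` of a finitely generated module `N` is everything as soon as `J + M N = N` for
every maximal ideal `M`. -/
theorem Submodule.eq_top_of_forall_isMaximal_top_le_sup_smul {R N : Type*} [CommRing R]
    [AddCommGroup N] [Module R N] [Module.Finite R N] (J : Submodule R N)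
    (h : ∀ M : Ideal R, M.IsMaximal → ⊤ ≤ J ⊔ M • (⊤ : Submodule R N)) : J = ⊤ := by
  by_contra hJ
  have hne : Module.annihilator R (N ⧸ J) ≠ ⊤ := by
    intro h0
    rw [Module.annihilator_eq_top_iff, Submodule.Quotient.subsingleton_iff] at h0
    exact hJ h0
  obtain ⟨M, hM, hle⟩ := Ideal.exists_le_maximal _ hne
  have hfg : (⊤ : Submodule R (N ⧸ J)).FG := Module.Finite.fg_top
  have hMQ : (⊤ : Submodule R (N ⧸ J)) ≤ M • ⊤ := by
    have h1 := Submodule.map_mono (f := J.mkQ) (h M hM)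
    rwa [Submodule.map_sup, Submodule.map_smul'', Submodule.map_top, Submodule.range_mkQ,
      Submodule.mkQ_map_self, bot_sup_eq] at h1
  -- Nakayama: some `r ≡ 1` modulo `M` kills `N ⧸ J`, although `M` contains its annihilator.
  obtain ⟨r, hr1, hr⟩ :=
    Submodule.exists_sub_one_mem_and_smul_eq_zero_of_fg_of_le_smul M _ hfg hMQ
  have hrM : r ∈ M := hle (Module.mem_annihilator.2 fun x => hr x trivial)
  exact hM.ne_top ((Ideal.eq_top_iff_one M).2 (by simpa using M.sub_mem hrM hr1))

/-- Chinese remaindering for finite families of vectors in a module. -/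
theorem Submodule.exists_forall_sub_mem_smul_top {R N ι κ : Type*} [CommRing R]
    [AddCommGroup N] [Module R N] [Finite ι] {P : ι → Ideal R}
    (hP : Pairwise (Function.onFun IsCoprime P)) (z : ι → κ → N) :
    ∃ x : κ → N, ∀ i k, x k - z i k ∈ P i • (⊤ : Submodule R N) := by
  classical
  have := Fintype.ofFinite ι
  choose e he using fun i => Ideal.exists_forall_sub_mem_ideal hP (Pi.single i (1 : R))
  refine ⟨fun k => ∑ i, e i • z i k, fun i k => ?_⟩
  have : ∑ j, e j • z j k - z i k
      = ∑ j, (e j - Pi.single (M := fun _ => R) j 1 i) • z j k := by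
    simp [sub_smul, Finset.sum_sub_distrib, Pi.single_apply]
  rw [this]
  exact Submodule.sum_mem _ fun j _ => Submodule.smul_mem_smul (he j i) trivial

/-- Steinitz exchange in a vector space. -/
theorem exists_span_sup_span_eq_top_of_linearIndependent {K W : Type*} [Field K]
    [AddCommGroup W] [Module K W] {n d : ℕ} {y : Fin n → W} (hy : LinearIndependent K y)
    {z : Fin d → W} (hz : Submodule.span K (Set.range z) = ⊤) :
    n ≤ d ∧ ∃ w : Fin (d - n) → W,
      Submodule.span K (Set.range y) ⊔ Submodule.span K (Set.range w) = ⊤ := by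
  have hfin : Module.Finite K W := ⟨Submodule.fg_def.2 ⟨_, Set.finite_range z, hz⟩⟩
  have hd : Module.finrank K W ≤ d := by
    have := finrank_range_le_card (R := K) z
    rwa [Set.finrank, hz, finrank_top, Fintype.card_fin] at this
  have hn : Module.finrank K (Submodule.span K (Set.range y)) = n := by
    simpa using finrank_span_eq_card hy
  have hadd := Submodule.finrank_quotient_add_finrank (Submodule.span K (Set.range y))
  refine ⟨by omega, ?_⟩
  set Y := Submodule.span K (Set.range y)
  let b := Module.finBasis K (W ⧸ Y)
  have hle : Module.finrank K (W ⧸ Y) ≤ d - n := by omega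
  choose l hl using fun i => Y.mkQ_surjective (b i)
  -- Lifts of a basis of `W ⧸ Y`, padded with zeros to length `d - n`.
  refine ⟨fun i => if hi : (i : ℕ) < Module.finrank K (W ⧸ Y) then l ⟨i, hi⟩ else 0, ?_⟩
  set w : Fin (d - n) → W :=
    fun i => if hi : (i : ℕ) < Module.finrank K (W ⧸ Y) then l ⟨i, hi⟩ else 0 with hw
  rw [← Submodule.map_mkQ_eq_top, eq_top_iff, ← b.span_eq, Submodule.span_le]
  rintro _ ⟨i, rfl⟩
  refine ⟨w ⟨i, i.2.trans_le hle⟩, Submodule.subset_span ⟨_, rfl⟩, ?_⟩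
  simp [hw, hl]

/-- Steinitz exchange modulo a maximal ideal. -/
theorem Ideal.IsMaximal.exists_top_le_span_sup {R N : Type*} [CommRing R]
    [AddCommGroup N] [Module R N] {M : Ideal R} (hM : M.IsMaximal) {n d : ℕ} {y : Fin n → N}
    (hy : ∀ s : Fin n → R, ∑ i, s i • y i ∈ M • (⊤ : Submodule R N) → ∀ i, s i ∈ M)
    {z : Fin d → N}
    (hz : ⊤ ≤ Submodule.span R (Set.range z) ⊔ M • (⊤ : Submodule R N)) :
    n ≤ d ∧ ∃ w : Fin (d - n) → N,
      ⊤ ≤ Submodule.span R (Set.range y) ⊔ Submodule.span R (Set.range w) ⊔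
        M • (⊤ : Submodule R N) := by
  let _ := Ideal.Quotient.field M
  set Q : Submodule R N := M • ⊤
  have hspan : ∀ {m : ℕ} (x : Fin m → N),
      (Submodule.span (R ⧸ M) (Set.range (Q.mkQ ∘ x))).restrictScalars R
        = (Submodule.span R (Set.range x)).map Q.mkQ := fun x => by
    rw [Submodule.restrictScalars_span _ _ Ideal.Quotient.mk_surjective, Submodule.map_span,
      Set.range_comp]
  have hy' : LinearIndependent (R ⧸ M) (Q.mkQ ∘ y) := by
    rw [Fintype.linearIndependent_iff]
    intro g hg i
    choose s hs using fun i => Ideal.Quotient.mk_surjective (g i)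
    rw [← hs, Ideal.Quotient.eq_zero_iff_mem]
    refine hy s ?_ i
    rw [← Submodule.Quotient.mk_eq_zero, ← Submodule.mkQ_apply, map_sum, ← hg]
    refine Finset.sum_congr rfl fun j _ => ?_
    rw [← hs]
    rfl
  have hz' : Submodule.span (R ⧸ M) (Set.range (Q.mkQ ∘ z)) = ⊤ := by
    rw [← Submodule.restrictScalars_eq_top_iff R, hspan, Submodule.map_mkQ_eq_top, sup_comm]
    exact top_le_iff.1 hz
  obtain ⟨hnd, w, hw⟩ := exists_span_sup_span_eq_top_of_linearIndependent hy' hz'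
  refine ⟨hnd, ?_⟩
  choose v hv using fun i => Q.mkQ_surjective (w i)
  refine ⟨v, ?_⟩
  obtain rfl : Q.mkQ ∘ v = w := funext hv
  have h2 := congrArg (Submodule.restrictScalars R) hw
  rw [Submodule.restrictScalars_sup, hspan, hspan, ← Submodule.map_sup,
    Submodule.restrictScalars_top, Submodule.map_mkQ_eq_top, sup_comm] at h2
  exact h2.ge

/-- A linear functional maps `M N` into `M`. -/
theorem LinearMap.apply_mem_of_mem_smul_top {R N : Type*} [CommRing R] [AddCommGroup N]
    [Module R N] (φ : N →ₗ[R] R) {M : Ideal R} {x : N} (hx : x ∈ M • (⊤ : Submodule R N)) :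
    φ x ∈ M := by
  induction hx using Submodule.smul_induction_on' with
  | smul r hr v _ => simpa using M.mul_mem_right _ hr
  | add _ _ _ _ h1 h2 => simpa using M.add_mem h1 h2

/-! ### Local-global generation over a PID -/

/-- Over a principal ideal domain, a finitely generated module all of whose reductions modulo
maximal ideals are spanned by `d` elements is itself spanned by `d` elements. -/
theorem IsPrincipalIdealRing.exists_span_range_eq_top {S V : Type*} [CommRing S] [IsDomain S]
    [IsPrincipalIdealRing S] [AddCommGroup V] [Module S V] [Module.Finite S V] {d : ℕ}
    (h : ∀ M : Ideal S, M.IsMaximal → ∃ z : Fin d → V,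
      ⊤ ≤ Submodule.span S (Set.range z) ⊔ M • (⊤ : Submodule S V)) :
    ∃ x : Fin d → V, Submodule.span S (Set.range x) = ⊤ := by
  set T := Submodule.torsion S V
  let b := Module.finBasis S (V ⧸ T)
  set n := Module.finrank S (V ⧸ T)
  choose y hyb using fun i => T.mkQ_surjective (b i)
  have hT' : Module.IsTorsion S T := Submodule.torsion_isTorsion
  obtain ⟨f, hf, hf0⟩ := Submodule.annihilator_top_inter_nonZeroDivisors hT'
  have hf0 : f ≠ 0 := nonZeroDivisors.ne_zero hf0
  have hfT : ∀ t ∈ T, f • t = 0 := fun t ht =>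
    congrArg Subtype.val (Submodule.mem_annihilator.1 hf (⟨t, ht⟩ : T) trivial)
  have hyind : ∀ M : Ideal S, ∀ s : Fin n → S,
      ∑ i, s i • y i ∈ M • (⊤ : Submodule S V) → ∀ i, s i ∈ M := by
    intro M s hs i
    have h1 := ((b.coord i).comp T.mkQ).apply_mem_of_mem_smul_top hs
    have h2 : ((b.coord i).comp T.mkQ) (∑ i, s i • y i) = s i := by
      simp only [map_sum, map_smul, LinearMap.comp_apply, hyb]
      simp [Finsupp.single_apply]
    rwa [h2] at h1
  choose z hz using h
  have hex := fun M (hM : Ideal.IsMaximal M) => hM.exists_top_le_span_sup (hyind M) (hz M hM)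
  -- A single maximal ideal suffices for `n ≤ d`, so that `n + (d - n) = d` at the end.
  obtain ⟨M₀, hM₀⟩ := Ideal.exists_maximal S
  have hnd : n ≤ d := (hex M₀ hM₀).1
  let ι := {M : Ideal S // M.IsMaximal ∧ f ∈ M}
  have : Finite ι := by
    have hfin := Ideal.finite_factors (R := S) (I := Ideal.span {f}) (by simpa using hf0)
    have := hfin.to_subtype
    refine Finite.of_injective (β := {v : IsDedekindDomain.HeightOneSpectrum S |
      v.asIdeal ∣ Ideal.span {f}}) (fun M => ⟨⟨M.1, M.2.1.isPrime, fun h0 => hf0 ?_⟩, ?_⟩) ?_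
    · simpa [h0] using M.2.2
    · simpa [Ideal.dvd_span_singleton] using M.2.2
    · intro M M' hMM
      exact Subtype.ext (by simpa using hMM)
  have hcop : Pairwise (Function.onFun IsCoprime fun i : ι => i.1) := fun i j hij =>
    have := i.2.1
    have := j.2.1
    Ideal.isCoprime_of_isMaximal fun h => hij (Subtype.ext h)
  obtain ⟨w, hw⟩ := Submodule.exists_forall_sub_mem_smul_top (N := V) hcop
    (fun i => (hex i.1 i.2.1).2.choose)
  have hspan : Submodule.span S (Set.range y) ⊔ Submodule.span S (Set.range w) = ⊤ := by
    refine Submodule.eq_top_of_forall_isMaximal_top_le_sup_smul _ fun M hM => ?_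
    by_cases hfM : f ∈ M
    · refine (hex M hM).2.choose_spec.trans (sup_le (sup_le ?_ ?_) le_sup_right)
      · exact le_sup_left.trans le_sup_left
      · rw [Submodule.span_le]
        rintro _ ⟨k, rfl⟩
        have h1 := hw ⟨M, hM, hfM⟩ k
        have h2 : w k ∈ Submodule.span S (Set.range y) ⊔ Submodule.span S (Set.range w) ⊔
            M • (⊤ : Submodule S V) :=
          (le_sup_right.trans le_sup_left : Submodule.span S (Set.range w) ≤ _)
            (Submodule.subset_span ⟨k, rfl⟩)
        simpa using Submodule.sub_mem _ h2 ((le_sup_right : M • (⊤ : Submodule S V) ≤ _) h1)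
    · intro v _
      have hv : v - ∑ i, b.repr (T.mkQ v) i • y i ∈ T := by
        rw [← Submodule.Quotient.mk_eq_zero, ← Submodule.mkQ_apply, map_sub, map_sum]
        simp only [map_smul, hyb, b.sum_repr, sub_self]
      -- Since `f` kills torsion and is invertible modulo `M`, the torsion part of `v` lies in `M
      -- V`.
      obtain ⟨a, m, hm, ham⟩ := hM.exists_inv hfM
      set t := v - ∑ i, b.repr (T.mkQ v) i • y i with ht
      have htm : t = m • t := by
        conv_lhs => rw [← one_smul S t, ← ham, add_smul, mul_smul, hfT t hv, smul_zero, zero_add]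
      have hv2 : v = ∑ i, b.repr (T.mkQ v) i • y i + m • t := by rw [← htm, ht]; abel
      rw [hv2]
      refine Submodule.add_mem_sup (Submodule.mem_sup_left ?_) (Submodule.smul_mem_smul hm trivial)
      exact Submodule.sum_mem _ fun i _ => Submodule.smul_mem _ _ (Submodule.subset_span ⟨i, rfl⟩)
  refine ⟨Fin.append y w ∘ Fin.cast (by omega), top_le_iff.1 (hspan.ge.trans ?_)⟩
  refine sup_le (Submodule.span_mono ?_) (Submodule.span_mono ?_)
  · rintro _ ⟨i, rfl⟩
    exact ⟨Fin.cast (by omega) (Fin.castAdd (d - n) i), by simp⟩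
  · rintro _ ⟨i, rfl⟩
    exact ⟨Fin.cast (by omega) (Fin.natAdd n i), by simp⟩

/-- Relative version, for a module over a ring with a quotient that is a principal ideal domain. -/
theorem Ideal.exists_top_le_span_sup_smul_of_isPrincipalIdealRing_quotient {R N : Type*}
    [CommRing R] [AddCommGroup N] [Module R N] [Module.Finite R N] (P : Ideal R) [P.IsPrime]
    [IsPrincipalIdealRing (R ⧸ P)] {d : ℕ}
    (h : ∀ M : Ideal R, M.IsMaximal → ∃ z : Fin d → N,
      ⊤ ≤ Submodule.span R (Set.range z) ⊔ M • (⊤ : Submodule R N)) :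
    ∃ x : Fin d → N, ⊤ ≤ Submodule.span R (Set.range x) ⊔ P • (⊤ : Submodule R N) := by
  set Q : Submodule R N := P • ⊤
  have hsurj : Function.Surjective (algebraMap R (R ⧸ P)) := Ideal.Quotient.mk_surjective
  have hspan : ∀ {m : ℕ} (x : Fin m → N),
      (Submodule.span (R ⧸ P) (Set.range (Q.mkQ ∘ x))).restrictScalars R
        = (Submodule.span R (Set.range x)).map Q.mkQ := fun x => by
    rw [Submodule.restrictScalars_span _ _ hsurj, Submodule.map_span, Set.range_comp]
  have : Module.Finite (R ⧸ P) (N ⧸ Q) := Module.Finite.of_restrictScalars_finite R _ _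
  obtain ⟨x, hx⟩ := IsPrincipalIdealRing.exists_span_range_eq_top (S := R ⧸ P) (V := N ⧸ Q)
    (d := d) fun M hM => by
      have hM' := Ideal.comap_isMaximal_of_surjective (algebraMap R (R ⧸ P)) hsurj (K := M)
      obtain ⟨z, hz⟩ := h _ hM'
      refine ⟨Q.mkQ ∘ z, ?_⟩
      have h1 := Submodule.map_mono (f := Q.mkQ) hz
      rw [Submodule.map_sup, Submodule.map_top, Submodule.range_mkQ, ← hspan,
        Submodule.map_smul''] at h1
      intro v hv
      rw [← Submodule.restrictScalars_mem R, Submodule.restrictScalars_sup]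
      obtain ⟨p, hp, q, hq, rfl⟩ := Submodule.mem_sup.1 (h1 hv)
      refine Submodule.add_mem_sup hp ?_
      rw [Submodule.restrictScalars_mem]
      clear h1 hv hz
      induction hq using Submodule.smul_induction_on' with
      | smul r hr v _ =>
        rw [← algebraMap_smul (R ⧸ P) r v]
        exact Submodule.smul_mem_smul (Ideal.mem_comap.1 hr) trivial
      | add _ _ _ _ h1 h2 => exact Submodule.add_mem _ h1 h2
  choose y hy using fun i => Q.mkQ_surjective (x i)
  obtain rfl : Q.mkQ ∘ y = x := funext hy
  refine ⟨y, ?_⟩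
  have h2 := congrArg (Submodule.restrictScalars R) hx
  rw [hspan, Submodule.restrictScalars_top, Submodule.map_mkQ_eq_top, sup_comm] at h2
  exact h2.ge

/-! ### Generators of localized ideals -/

theorem Submodule.exists_fin_span_range_eq_of_spanRank_le {R N : Type*} [CommRing R]
    [AddCommGroup N] [Module R N] {p : Submodule R N} {d : ℕ} (h : p.spanRank ≤ d) :
    ∃ z : Fin d → N, Submodule.span R (Set.range z) = p := by
  obtain ⟨s, hs, rfl⟩ := (FG.spanRank_le_iff_exists_span_set_card_le p).1 h
  obtain ⟨e⟩ : Nonempty (s ↪ Fin d) := by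
    rw [← Cardinal.lift_mk_le']
    simpa using hs
  refine ⟨Function.extend e Subtype.val 0, le_antisymm (span_le.2 ?_) (span_mono fun x hx =>
    ⟨e ⟨x, hx⟩, e.injective.extend_apply _ _ _⟩)⟩
  rintro _ ⟨i, rfl⟩
  by_cases hi : ∃ a, e a = i
  · obtain ⟨a, rfl⟩ := hi
    rw [e.injective.extend_apply]
    exact subset_span a.2
  · rw [Function.extend_apply' _ _ _ hi]
    exact zero_mem _

/-- If the extension of `I` to the localization at `M` is spanned by `d` elements, then so is
`I / M I`. -/
theorem Ideal.exists_top_le_span_sup_of_spanRank_map_le {R : Type*} [CommRing R] {M : Ideal R}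
    (hM : M.IsMaximal) (I : Ideal R) {d : ℕ}
    (h : (I.map (algebraMap R (Localization.AtPrime M))).spanRank ≤ d) :
    ∃ z : Fin d → I, ⊤ ≤ Submodule.span R (Set.range z) ⊔ M • (⊤ : Submodule R I) := by
  obtain ⟨g, hg⟩ := Submodule.exists_fin_span_range_eq_of_spanRank_le h
  have hgI : ∀ i, g i ∈ I.map (algebraMap R (Localization.AtPrime M)) := fun i =>
    hg ▸ Submodule.subset_span ⟨i, rfl⟩
  simp only [IsLocalization.mem_map_algebraMap_iff M.primeCompl] at hgI
  choose a ha using hgI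
  let z : Fin d → I := fun i => (a i).1
  let J : Ideal R := (Submodule.span R (Set.range z)).map I.subtype
  have hIJ : I.map (algebraMap R (Localization.AtPrime M)) ≤
      J.map (algebraMap R (Localization.AtPrime M)) := by
    rw [← hg, Submodule.span_le]
    rintro _ ⟨i, rfl⟩
    refine (IsLocalization.mem_map_algebraMap_iff M.primeCompl _).2
      ⟨⟨⟨z i, Submodule.mem_map_of_mem (Submodule.subset_span ⟨i, rfl⟩)⟩, (a i).2⟩, ha i⟩
  refine ⟨z, fun y _ => ?_⟩
  obtain ⟨⟨j, s⟩, hjs⟩ := (IsLocalization.mem_map_algebraMap_iff M.primeCompl _).1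
    (hIJ (Ideal.mem_map_of_mem _ y.2))
  rw [← map_mul, IsLocalization.eq_iff_exists M.primeCompl] at hjs
  obtain ⟨u, hu⟩ := hjs
  -- The cleared denominator `u * s` is invertible modulo `M`, so it can be divided out up to `M I`.
  have hus : (u * s : R) ∉ M := (u * s).2
  have hmem : (u * s : R) • y ∈ Submodule.span R (Set.range z) := by
    obtain ⟨w, hw, hwj⟩ := j.2
    have : (u * s : R) • y = (u : R) • w := by
      apply Subtype.ext
      have : (w : R) = j := hwj
      simp only [SetLike.val_smul, smul_eq_mul, this, ← hu]
      ring
    rw [this]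
    exact Submodule.smul_mem _ _ hw
  obtain ⟨r, m, hm, hrm⟩ := hM.exists_inv hus
  rw [← one_smul R y, ← hrm, add_smul, mul_smul]
  exact Submodule.add_mem_sup (Submodule.smul_mem _ _ hmem) (Submodule.smul_mem_smul hm trivial)

/-! ### Artinian coefficients -/

/-- Over a polynomial ring in one variable over an Artinian ring, a finitely generated module all
of whose reductions modulo maximal ideals are spanned by `d` elements is spanned by `d` elements. -/
theorem IsArtinianRing.exists_span_range_eq_top_of_polynomial {A N : Type*} [CommRing A]
    [IsArtinianRing A] [AddCommGroup N] [Module A[X] N] [Module.Finite A[X] N] {d : ℕ}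
    (h : ∀ M : Ideal A[X], M.IsMaximal → ∃ z : Fin d → N,
      ⊤ ≤ Submodule.span A[X] (Set.range z) ⊔ M • (⊤ : Submodule A[X] N)) :
    ∃ x : Fin d → N, Submodule.span A[X] (Set.range x) = ⊤ := by
  let P : MaximalSpectrum A → Ideal A[X] := fun p => p.asIdeal.map Polynomial.C
  have hPx : ∀ p, ∃ x : Fin d → N,
      ⊤ ≤ Submodule.span A[X] (Set.range x) ⊔ P p • (⊤ : Submodule A[X] N) := fun p => by
    have := p.isMaximal
    let _ := Ideal.Quotient.field p.asIdeal
    have : (P p).IsPrime := Ideal.isPrime_map_C_of_isPrime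
    have : IsPrincipalIdealRing (A[X] ⧸ P p) :=
      IsPrincipalIdealRing.of_surjective
        (p.asIdeal.polynomialQuotientEquivQuotientPolynomial : (A ⧸ p.asIdeal)[X] →+* _)
        (RingEquiv.surjective _)
    exact Ideal.exists_top_le_span_sup_smul_of_isPrincipalIdealRing_quotient (P p) h
  choose z hz using hPx
  have hcop : Pairwise (Function.onFun IsCoprime P) := fun p q hpq => by
    have := p.isMaximal
    have := q.isMaximal
    have h1 := Ideal.isCoprime_of_isMaximal (I := p.asIdeal) (J := q.asIdeal) fun h =>
      hpq (MaximalSpectrum.ext h)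
    rw [Ideal.isCoprime_iff_sup_eq] at h1
    rw [Function.onFun, Ideal.isCoprime_iff_sup_eq, ← Ideal.map_sup, h1, Ideal.map_top]
  obtain ⟨x, hx⟩ := Submodule.exists_forall_sub_mem_smul_top (N := N) hcop z
  refine ⟨x, Submodule.eq_top_of_forall_isMaximal_top_le_sup_smul _ fun M hM => ?_⟩
  -- The contraction of `M` is prime, hence maximal because `A` is Artinian.
  let p : MaximalSpectrum A := ⟨M.comap Polynomial.C, inferInstance⟩
  have hPM : P p • (⊤ : Submodule A[X] N) ≤ M • ⊤ :=
    Submodule.smul_mono_left Ideal.map_comap_le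
  refine (hz p).trans (sup_le (Submodule.span_le.2 ?_) (hPM.trans le_sup_right))
  rintro _ ⟨k, rfl⟩
  rw [← sub_sub_cancel (x k) (z p k)]
  exact Submodule.sub_mem _ (Submodule.mem_sup_left (Submodule.subset_span ⟨k, rfl⟩))
    (Submodule.mem_sup_right (hPM (hx p k)))

/-! ### Non-Artinian coefficients -/

/-- A Noetherian ring that is not Artinian has a maximal ideal whose powers strictly decrease. -/
theorem IsNoetherianRing.exists_isMaximal_pow_succ_ne {A : Type*} [CommRing A]
    [IsNoetherianRing A] (hA : ¬ IsArtinianRing A) :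
    ∃ m : Ideal A, m.IsMaximal ∧ ∀ i, ∃ a ∈ m ^ i, a ∉ m ^ (i + 1) := by
  have hdim : ¬ Ring.KrullDimLE 0 A := fun h =>
    hA (isArtinianRing_iff_isNoetherianRing_krullDimLE_zero.2 ⟨inferInstance, h⟩)
  rw [Ring.krullDimLE_zero_iff] at hdim
  push Not at hdim
  obtain ⟨P, hP, hPmax⟩ := hdim
  obtain ⟨m, hm, hPm⟩ := P.exists_le_maximal hP.ne_top
  refine ⟨m, hm, fun i => ?_⟩
  by_contra! hi
  have hle : m ^ i ≤ m • m ^ i := by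
    rw [smul_eq_mul, ← pow_succ']
    exact hi
  -- If the powers stabilized, some `r ∉ m` would kill `m ^ i`, forcing `m ≤ P` and making `P`
  -- maximal.
  obtain ⟨r, hr1, hr⟩ := Submodule.exists_sub_one_mem_and_smul_eq_zero_of_fg_of_le_smul m (m ^ i)
    (IsNoetherian.noetherian _) hle
  have hrm : r ∉ m := fun hrm =>
    hm.ne_top ((Ideal.eq_top_iff_one m).2 (by simpa using m.sub_mem hrm hr1))
  have hmP : m ≤ P := hP.le_of_pow_le (n := i) fun x hx =>
    (hP.mem_or_mem (by rw [← smul_eq_mul, hr x hx]; exact P.zero_mem : r * x ∈ P)).resolve_left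
      fun h => hrm (hPm h)
  exact hPmax (le_antisymm hPm hmP ▸ hm)

/-- The comap is `(m, X)`. In a product of `k` of its elements, at most `j` factors can contribute a
positive power of `X` to degree `j`; the others contribute constant terms in `m`. For `j ≥ k` the
truncated exponent is 0 and nothing is claimed. -/
theorem Polynomial.coeff_mem_pow_of_mem_comap_constantCoeff_pow {A : Type*} [CommRing A]
    {m : Ideal A} (k : ℕ) : ∀ {f : A[X]}, f ∈ (m.comap Polynomial.constantCoeff) ^ k →
      ∀ j, f.coeff j ∈ m ^ (k - j) := by
  induction k with
  | zero => simp
  | succ k ih =>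
    intro f hf j
    rw [pow_succ] at hf
    induction hf using Submodule.mul_induction_on' with
    | mem_mul_mem f hf g hg =>
      rw [Polynomial.coeff_mul]
      refine Ideal.sum_mem _ fun ⟨a, b⟩ hab => ?_
      rw [Finset.HasAntidiagonal.mem_antidiagonal] at hab
      obtain rfl | hb := Nat.eq_zero_or_pos b
      · refine Ideal.pow_le_pow_right (by omega : k + 1 - j ≤ (k - a) + 1) ?_
        rw [pow_succ]
        exact Ideal.mul_mem_mul (ih hf a) hg
      · exact Ideal.mul_mem_right _ _
          (Ideal.pow_le_pow_right (by omega : k + 1 - j ≤ k - a) (ih hf a))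
    | add f _ g _ h1 h2 =>
      rw [Polynomial.coeff_add]
      exact Ideal.add_mem _ h1 h2

/-- If the powers of a maximal ideal `m` strictly decrease, then the `d`-th power of `(m, X)` is
not spanned by `d` elements, even modulo `(m, X)`. -/
theorem Polynomial.not_top_le_span_sup_of_pow_succ_ne {A : Type*} [CommRing A] {m : Ideal A}
    (hm : m.IsMaximal) (hpow : ∀ i, ∃ a ∈ m ^ i, a ∉ m ^ (i + 1)) (d : ℕ)
    (z : Fin d → ↥(m.comap (Polynomial.constantCoeff (R := A)) ^ d)) :
    ¬ ⊤ ≤ Submodule.span A[X] (Set.range z) ⊔ m.comap Polynomial.constantCoeff • ⊤ := by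
  intro hz
  set M : Ideal A[X] := m.comap Polynomial.constantCoeff with hMdef
  have hsurj : Function.Surjective (Polynomial.constantCoeff (R := A)) := fun a =>
    ⟨Polynomial.C a, by simp⟩
  have hM : M.IsMaximal := Ideal.comap_isMaximal_of_surjective _ hsurj
  choose a ha ha' using hpow
  have hXM : (Polynomial.X : A[X]) ∈ M := by simp [hMdef]
  have hCM : ∀ i, Polynomial.C (a i) ∈ M ^ i := fun i => by
    have h1 : m.map Polynomial.C ≤ M := Ideal.map_le_iff_le_comap.2 fun x hx => by
      simpa [hMdef] using hx
    have h2 := Ideal.mem_map_of_mem Polynomial.C (ha i)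
    rw [Ideal.map_pow] at h2
    exact Ideal.pow_right_mono h1 i h2
  let y : Fin (d + 1) → ↥(M ^ d) := fun i => ⟨Polynomial.C (a i) * Polynomial.X ^ (d - i), by
    have h1 := Ideal.mul_mem_mul (hCM i) (Ideal.pow_mem_pow hXM (d - i))
    rwa [← pow_add, Nat.add_sub_cancel' (Nat.lt_succ_iff.1 i.2)] at h1⟩
  have hy : ∀ s : Fin (d + 1) → A[X], ∑ i, s i • y i ∈ M • (⊤ : Submodule A[X] ↥(M ^ d)) →
      ∀ i, s i ∈ M := by
    intro s hs j
    have h1 := Submodule.mem_map_of_mem (f := (M ^ d).subtype) hs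
    rw [Submodule.map_smul'', Submodule.map_top, Submodule.range_subtype, smul_eq_mul,
      ← pow_succ'] at h1
    -- In degree `d - j`, terms with `i < j` vanish and those with `i > j` lie in `m ^ (j + 1)`,
    -- which isolates `(s j).coeff 0 * a j`.
    have h2 := Polynomial.coeff_mem_pow_of_mem_comap_constantCoeff_pow _ h1 (d - j)
    rw [show d + 1 - (d - j) = j + 1 by omega, map_sum, Polynomial.finsetSum_coeff,
      ← Finset.add_sum_erase _ _ (Finset.mem_univ j)] at h2
    have hterm : ∀ i, ((M ^ d).subtype (s i • y i)).coeff (d - j) =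
        if d - i ≤ d - j then (s i).coeff (d - j - (d - i)) * a i else 0 := fun i => by
      simp only [map_smul, Submodule.subtype_apply, smul_eq_mul, y]
      rw [← mul_assoc, Polynomial.coeff_mul_X_pow', Polynomial.coeff_mul_C]
    have h3 : (s j).coeff 0 * a j ∈ m ^ ((j : ℕ) + 1) := by
      have h4 : ∑ i ∈ Finset.univ.erase j, ((M ^ d).subtype (s i • y i)).coeff (d - j) ∈
          m ^ ((j : ℕ) + 1) := Ideal.sum_mem _ fun i hi => by
        rw [hterm]
        split_ifs with hij
        · have : (i : ℕ) ≠ j := fun h => (Finset.mem_erase.1 hi).1 (Fin.ext h)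
          exact Ideal.mul_mem_left _ _ (Ideal.pow_le_pow_right (by omega) (ha i))
        · exact Ideal.zero_mem _
      have h5 := Ideal.sub_mem _ h2 h4
      rw [add_sub_cancel_right, hterm] at h5
      simpa using h5
    by_contra hsM
    have hs0 : (s j).coeff 0 ∉ m := fun h => hsM h
    obtain ⟨r, t, ht, hrt⟩ := hm.exists_inv hs0
    refine ha' j ?_
    rw [← one_mul (a j), ← hrt, add_mul, mul_assoc]
    refine Ideal.add_mem _ (Ideal.mul_mem_left _ _ h3) ?_
    rw [pow_succ']
    exact Ideal.mul_mem_mul ht (ha j)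
  have := (hM.exists_top_le_span_sup hy hz).1
  omega

/-! ### Comparison of rk and lrk -/

theorem spanRank_le_ringRk {R : Type u} [CommRing R] (I : Ideal R) :
    Submodule.spanRank I ≤ ringRk R :=
  le_ciSup (f := fun I : Ideal R => Submodule.spanRank I) (Cardinal.bddAbove_of_small) I

theorem ringRk_le_ringLrk {R : Type u} [CommRing R] (M : MaximalSpectrum R) :
    ringRk (Localization.AtPrime M.asIdeal) ≤ ringLrk R :=
  le_ciSup (f := fun M : MaximalSpectrum R => ringRk (Localization.AtPrime M.asIdeal))
    (Cardinal.bddAbove_of_small) M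

theorem ringLrk_le_ringRk (R : Type u) [CommRing R] : ringLrk R ≤ ringRk R := by
  refine ciSup_le' fun M => ciSup_le' fun J => ?_
  rw [← IsLocalization.map_under M.asIdeal.primeCompl (Localization.AtPrime M.asIdeal) J]
  exact (Ideal.spanRank_map_le _ _).trans (spanRank_le_ringRk _)

theorem ringRk_le_aleph0 (R : Type u) [CommRing R] [IsNoetherianRing R] :
    ringRk R ≤ Cardinal.aleph0 :=
  ciSup_le' fun I => (Submodule.spanRank_finite_iff_fg.2 (IsNoetherian.noetherian I)).le

theorem exists_top_le_span_sup_of_ringLrk_eq {R : Type u} [CommRing R] {d : ℕ}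
    (hd : ringLrk R = d) (I : Ideal R) {M : Ideal R} (hM : M.IsMaximal) :
    ∃ z : Fin d → I, ⊤ ≤ Submodule.span R (Set.range z) ⊔ M • (⊤ : Submodule R I) :=
  Ideal.exists_top_le_span_sup_of_spanRank_map_le hM I
    (((spanRank_le_ringRk _).trans (ringRk_le_ringLrk ⟨M, hM⟩)).trans hd.le)

theorem IsArtinianRing.isOfLocalRank_polynomial (A : Type u) [CommRing A] [IsArtinianRing A] :
    IsOfLocalRank A[X] := by
  refine le_antisymm ?_ (ringLrk_le_ringRk _)
  obtain hinf | hfin := le_or_gt Cardinal.aleph0 (ringLrk A[X])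
  · exact (ringRk_le_aleph0 _).trans hinf
  obtain ⟨d, hd⟩ := Cardinal.lt_aleph0.1 hfin
  refine ciSup_le' fun I => ?_
  obtain ⟨x, hx⟩ := IsArtinianRing.exists_span_range_eq_top_of_polynomial
    fun M hM => exists_top_le_span_sup_of_ringLrk_eq hd I hM
  rw [hd, ← Submodule.spanRank_top, ← hx]
  refine (Submodule.spanRank_span_le_card _).trans ?_
  simpa using Cardinal.mk_range_le_lift (f := x)

theorem IsNoetherianRing.isOfLocalRank_polynomial (A : Type u) [CommRing A]
    [IsNoetherianRing A] : IsOfLocalRank A[X] := by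
  by_cases hA : IsArtinianRing A
  · exact IsArtinianRing.isOfLocalRank_polynomial A
  refine le_antisymm ((ringRk_le_aleph0 _).trans ?_) (ringLrk_le_ringRk _)
  -- It suffices that lrk is infinite: a finite value `d` would bound the generators of `(m, X) ^ d`
  -- modulo `(m, X)`.
  by_contra! hfin
  obtain ⟨d, hd⟩ := Cardinal.lt_aleph0.1 hfin
  obtain ⟨m, hm, hpow⟩ := IsNoetherianRing.exists_isMaximal_pow_succ_ne hA
  have hM : (m.comap (Polynomial.constantCoeff (R := A))).IsMaximal :=
    Ideal.comap_isMaximal_of_surjective _ fun a => ⟨Polynomial.C a, by simp⟩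
  obtain ⟨z, hz⟩ := exists_top_le_span_sup_of_ringLrk_eq hd
    (m.comap (Polynomial.constantCoeff (R := A)) ^ d) hM
  exact Polynomial.not_top_le_span_sup_of_pow_succ_ne hm hpow d z hz

/-! ### Isomorphism invariance and the theorem -/

theorem RingEquiv.ringRk_le {R S : Type u} [CommRing R] [CommRing S] (e : R ≃+* S) :
    ringRk R ≤ ringRk S := by
  refine ciSup_le' fun I => ?_
  rw [← Ideal.spanRank_map_eq_of_ringEquiv e I]
  exact spanRank_le_ringRk _

theorem RingEquiv.ringLrk_le {R S : Type u} [CommRing R] [CommRing S] (e : R ≃+* S) :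
    ringLrk R ≤ ringLrk S := by
  refine ciSup_le' fun M => ?_
  have := M.isMaximal
  have hM : (M.asIdeal.comap e.symm).IsMaximal :=
    Ideal.comap_isMaximal_of_surjective _ e.symm.surjective
  refine le_trans (RingEquiv.ringRk_le ?_) (ringRk_le_ringLrk ⟨_, hM⟩)
  refine IsLocalization.ringEquivOfRingEquiv (M := M.asIdeal.primeCompl)
    (T := (M.asIdeal.comap e.symm).primeCompl) _ _ e ?_
  ext x
  constructor
  · rintro ⟨y, hy, rfl⟩
    simpa [Ideal.mem_primeCompl_iff] using hy
  · intro hx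
    exact ⟨e.symm x, hx, e.apply_symm_apply x⟩

theorem IsOfLocalRank.of_ringEquiv {R S : Type u} [CommRing R] [CommRing S] (e : R ≃+* S)
    (h : IsOfLocalRank R) : IsOfLocalRank S :=
  le_antisymm (e.symm.ringRk_le.trans (h.le.trans e.ringLrk_le)) (ringLrk_le_ringRk S)

theorem mainTheorem4 (A : Type u) [CommRing A] :
    (IsArtinianRing A → IsOfLocalRank A[X]) ∧
    (∀ n : ℕ, 1 ≤ n → IsNoetherianRing (MvPolynomial (Fin n) A) →
      IsOfLocalRank (MvPolynomial (Fin n) A)) := by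
  refine ⟨fun _ => IsArtinianRing.isOfLocalRank_polynomial A, fun n hn hnoeth => ?_⟩
  obtain ⟨n, rfl⟩ := Nat.exists_eq_add_of_le' hn
  have : IsNoetherianRing A := isNoetherianRing_of_surjective _ A
    (MvPolynomial.constantCoeff (σ := Fin (n + 1))) fun a => ⟨MvPolynomial.C a, by simp⟩
  exact (IsNoetherianRing.isOfLocalRank_polynomial (MvPolynomial (Fin n) A)).of_ringEquiv
    (MvPolynomial.finSuccEquiv A n).toRingEquiv.symm
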